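/- Let $\ell_p$ denote the usual spaces of real sequences $(x_k)_{k\ge 1}$. For $x\in\ell_2$ and $s>0$ put $$K_{1,2}(x,s)=\inf\{\|x'\|_1+s\|x''\|_2 : x',x''\in\ell_2,\ x'+x''=x\}.$$ Call $c>0$ a tail constant if, for independent Rademacher variables $\epsilon_1,\epsilon_2,\dots$ (each equal to $\pm1$ with probability $1/2$), $$P\Big(\sum_{k\ge1}x_k\epsilon_k\ge c^{-1}K_{1,2}(x,s)\Big)\ge c^{-1}e^{-cs^2}\qquad\text{for all }x\in\ell_2,\ s>0. \tag{1}$$ A tail constant exists (Montgomery-Smith). Moreover, for every tail constant $c>0$ the following holds. Let $B$ be a real topological vector space whose topology is given by a complete, separable, translation-invariant metric, let $X$ be a $B$-valued Borel random vector with law $\mu$, and let $t_k:B\to\mathbb{R}$, $k\ge1$, be Borel measurable functions (not necessarily linear or continuous) such that $\{t_k(X):k\ge1\}$ are independent Rademacher random variables. Let $\mathcal T$ be the set of all finite linear combinations of the functions $t_k$, and for $a\in B$ let $$HD_{\mathcal T}(a,\mu)=\inf_{t\in\mathcal T}\mu(\{x\in B: t(x)\ge t(a)\}).$$ If $a\in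 B$ satisfies $\sum_{k\ge1}t_k(a)^2<\infty$ and, for some $t_0>0$, $$\max\Big\{c\,\|(t_k(a))_{k\ge1}\|_\infty,\ t_0^{-1}c\,\|(t_k(a))_{k\ge1}\|_2\Big\}\le 1,$$ then $$HD_{\mathcal T}(a,\mu)\ge c^{-1}e^{-ct_0^2}.$$ -/

import Mathlib

open MeasureTheory ProbabilityTheory Filter Topology
open scoped ENNReal

noncomputable section

/-- The half space depth of `a : B` with respect to a collection `T` of functionals on `B` and a
measure `μ` on `B`: the infimum over `t ∈ T` of `μ {x | t x ≥ t a}`. -/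
def halfSpaceDepth {B : Type*} [MeasurableSpace B] (T : Set (B → ℝ)) (a : B) (μ : Measure B) : ℝ :=
  ⨅ t : T, μ.real {x | t.1 x ≥ t.1 a}

/-- The law of a Rademacher random variable: mass `1/2` at each of `1` and `-1`. -/
def rademacherLaw : Measure ℝ :=
  (2⁻¹ : ℝ≥0∞) • Measure.dirac 1 + (2⁻¹ : ℝ≥0∞) • Measure.dirac (-1)

instance isProbabilityMeasure_rademacherLaw : IsProbabilityMeasure rademacherLaw := by
  constructor
  simp [rademacherLaw, ENNReal.inv_two_add_inv_two]

/-- The joint law, on `ℝ^ℕ`, of a sequence of independent Rademacher random variables. -/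
def rademacherSeqLaw : Measure (ℕ → ℝ) := Measure.infinitePi fun _ => rademacherLaw

/-- The K-functional of the pair `(ℓ₁, ℓ₂)`: for `x ∈ ℓ₂` and `s > 0`, the infimum of
`‖x'‖₁ + s * ‖x''‖₂` over all decompositions `x = x' + x''` in `ℓ₂`. Decompositions with
`‖x'‖₁ = ∞` do not affect the infimum and are left out. -/
def kFunctional (x : lp (fun _ : ℕ => ℝ) 2) (s : ℝ) : ℝ :=
  sInf {r : ℝ | ∃ x' x'' : lp (fun _ : ℕ => ℝ) 2,
    x' + x'' = x ∧ Summable (fun k => |x' k|) ∧ r = (∑' k, |x' k|) + s * ‖x''‖}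

/-- `c` is a constant for which the lower tail bound
`P (∑ x_k ε_k ≥ c⁻¹ K(x, s)) ≥ c⁻¹ exp (-c s²)` holds for all `x ∈ ℓ₂` and all `s > 0`, where
`ε_0, ε_1, …` are independent Rademacher variables. The random series is the limit of its partial
sums (it converges almost surely, in general not absolutely). -/
def IsRademacherTailConstant (c : ℝ) : Prop :=
  ∀ (x : lp (fun _ : ℕ => ℝ) 2) (s : ℝ), 0 < s →
    c⁻¹ * Real.exp (-c * s ^ 2) ≤
      rademacherSeqLaw.real {ε | ∃ S : ℝ,
        Tendsto (fun n => ∑ k ∈ Finset.range n, x k * ε k) atTop (𝓝 S) ∧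
          S ≥ c⁻¹ * kFunctional x s}

end

/-! ### Independent Rademacher variables as coordinates of `rademacherSeqLaw` -/

/-! Depth bound: the hypothesis puts `(t k a)` in `c⁻¹` times the unit ball of the norm dual to
`K(·, t₀)`. So for a finite combination with coefficients `b`, its value at `a` is at most `c⁻¹ K(b,
t₀)` (`tsum_mul_le_kFunctional`). The `t k (X)` have the joint law of independent signs, so the tail
bound at `x = b`, `s = t₀` bounds every half space at once.

Existence of a tail constant: up to an `ℓ₂` tail, `K(x, s)` is at most some `∑ |x k| y k` with `0 ≤
y ≤ 1` and `∑ y² ≤ s²` (`exists_truncation_weights`). Cut the indices into blocks with `∑ y²` about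
one; there are about `s²` of them. On a block, Cauchy–Schwarz bounds `∑ |x k| y k` by a multiple of
the `ℓ₂` norm, which the random sum exceeds, up to a constant, with probability bounded below
(`rademacherSum_tail`). Independence multiplies these probabilities
(`rademacherSum_tail_of_weights`). Martingale convergence carries the bound from partial sums to the
series. -/

instance isProbabilityMeasure_rademacherSeqLaw : IsProbabilityMeasure rademacherSeqLaw := by
  unfold rademacherSeqLaw; infer_instance

lemma rademacherSeqLaw_map_eval (k : ℕ) :
    rademacherSeqLaw.map (fun ε => ε k) = rademacherLaw :=
  Measure.infinitePi_map_eval (fun _ : ℕ => rademacherLaw) k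

lemma iIndepFun_eval_rademacherSeqLaw :
    iIndepFun (fun (k : ℕ) (ε : ℕ → ℝ) => ε k) rademacherSeqLaw :=
  iIndepFun_infinitePi (P := fun _ : ℕ => rademacherLaw) (X := fun _ x => x) (by fun_prop)

lemma ae_rademacherSeqLaw_eval :
    ∀ᵐ ε ∂rademacherSeqLaw, ∀ k, ε k = 1 ∨ ε k = -1 := by
  rw [ae_all_iff]
  intro k
  have hs : MeasurableSet {x : ℝ | x = 1 ∨ x = -1} :=
    ((Set.finite_singleton (-1 : ℝ)).insert 1).measurableSet
  have h : ∀ᵐ x ∂rademacherLaw, x = 1 ∨ x = -1 := by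
    rw [ae_iff]
    have := hs.compl
    simp only [rademacherLaw, Measure.add_apply, Measure.smul_apply]
    rw [show {x : ℝ | ¬(x = 1 ∨ x = -1)} = {x : ℝ | x = 1 ∨ x = -1}ᶜ from rfl,
      Measure.dirac_apply' _ this, Measure.dirac_apply' _ this]
    simp
  rw [← rademacherSeqLaw_map_eval k, ae_map_iff (f := fun ε : ℕ → ℝ => ε k)
    (measurable_pi_apply k).aemeasurable hs] at h
  exact h

lemma integral_eval_rademacherSeqLaw (k : ℕ) : ∫ ε, ε k ∂rademacherSeqLaw = 0 := by
  have h : ∫ x, x ∂rademacherLaw = 0 := by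
    unfold rademacherLaw
    rw [integral_add_measure]
    · simp
    · exact (integrable_dirac (by simp)).smul_measure (by simp)
    · exact (integrable_dirac (by simp)).smul_measure (by simp)
  rw [← rademacherSeqLaw_map_eval k, integral_map (measurable_pi_apply k).aemeasurable
    (by fun_prop)] at h
  exact h

lemma measurable_rademacherSum (A : Finset ℕ) (a : ℕ → ℝ) :
    Measurable fun ε : ℕ → ℝ => ∑ k ∈ A, a k * ε k :=
  Finset.measurable_sum _ fun k _ => (measurable_pi_apply k).const_mul _

lemma ae_abs_rademacherSum_le (A : Finset ℕ) (a : ℕ → ℝ) :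
    ∀ᵐ ε ∂rademacherSeqLaw, |∑ k ∈ A, a k * ε k| ≤ ∑ k ∈ A, |a k| := by
  filter_upwards [ae_rademacherSeqLaw_eval] with ε hε
  refine (Finset.abs_sum_le_sum_abs _ _).trans (Finset.sum_le_sum fun k _ => ?_)
  rcases hε k with h | h <;> simp [h]

lemma integrable_comp_rademacherSum {F : ℝ → ℝ} (hF : Continuous F) (A : Finset ℕ)
    (a : ℕ → ℝ) : Integrable (fun ε => F (∑ k ∈ A, a k * ε k)) rademacherSeqLaw := by
  obtain ⟨C, hC⟩ := (isCompact_Icc (a := -∑ k ∈ A, |a k|)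
    (b := ∑ k ∈ A, |a k|)).exists_bound_of_continuousOn hF.continuousOn
  refine Integrable.of_bound
    (hF.measurable.comp (measurable_rademacherSum A a)).aestronglyMeasurable C ?_
  filter_upwards [ae_abs_rademacherSum_le A a] with ε hε
  exact hC _ (abs_le.1 hε)

/-- Averaging over one more independent sign. -/
lemma integral_comp_rademacherSum_insert {F : ℝ → ℝ} (hF : Continuous F) {A : Finset ℕ} {i : ℕ}
    (hi : i ∉ A) (a : ℕ → ℝ) :
    ∫ ε, F (∑ k ∈ insert i A, a k * ε k) ∂rademacherSeqLaw =
      ∫ ε, (F (∑ k ∈ A, a k * ε k + a i) + F (∑ k ∈ A, a k * ε k - a i)) / 2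
        ∂rademacherSeqLaw := by
  -- For a sign `e`, `F (u + a i * e)` is the average of `F (u ± a i)` plus `G u * e`; the second
  -- term has mean zero because `ε i` is centred and independent of the sum over `A`.
  set G : ℝ → ℝ := fun u => (F (u + a i) - F (u - a i)) / 2 with hG
  have hGc : Continuous G := by fun_prop
  have hind : IndepFun (fun ε : ℕ → ℝ => G (∑ k ∈ A, a k * ε k)) (fun ε => ε i)
      rademacherSeqLaw := by
    have h := iIndepFun_eval_rademacherSeqLaw.indepFun_finset A {i}
      (Finset.disjoint_singleton_right.2 hi) (fun k => measurable_pi_apply k)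
    have h2 := h.comp (φ := fun u : A → ℝ => G (∑ k : A, a k * u k))
      (ψ := fun u : ({i} : Finset ℕ) → ℝ => u ⟨i, by simp⟩)
      (hGc.measurable.comp (by fun_prop))
      (measurable_pi_apply (X := fun _ : ({i} : Finset ℕ) => ℝ) ⟨i, by simp⟩)
    have e : (fun ε : ℕ → ℝ => G (∑ k ∈ A, a k * ε k)) =
        fun ε : ℕ → ℝ => G (∑ k : A, a k * ε k) := by
      funext ε
      rw [← Finset.sum_coe_sort A]
    rw [e]
    exact h2
  have hGi := integrable_comp_rademacherSum hGc A a
  have hz : ∫ ε, G (∑ k ∈ A, a k * ε k) * ε i ∂rademacherSeqLaw = 0 := by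
    rw [hind.integral_fun_mul_eq_mul_integral hGi.aestronglyMeasurable
      (measurable_pi_apply i).aestronglyMeasurable, integral_eval_rademacherSeqLaw, mul_zero]
  have hGe : Integrable (fun ε => G (∑ k ∈ A, a k * ε k) * ε i) rademacherSeqLaw := by
    refine hGi.mul_bdd (c := 1) (measurable_pi_apply i).aestronglyMeasurable ?_
    filter_upwards [ae_rademacherSeqLaw_eval] with ε hε
    rcases hε i with h | h <;> simp [h]
  have hav := integrable_comp_rademacherSum
    (F := fun u => (F (u + a i) + F (u - a i)) / 2) (by fun_prop) A a
  rw [← add_zero (∫ ε, (F (∑ k ∈ A, a k * ε k + a i) + F (∑ k ∈ A, a k * ε k - a i)) / 2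
        ∂rademacherSeqLaw), ← hz, ← integral_add hav hGe]
  refine integral_congr_ae ?_
  filter_upwards [ae_rademacherSeqLaw_eval] with ε hε
  simp only [hG]
  rw [Finset.sum_insert hi]
  rcases hε i with h | h
  · rw [h, mul_one, add_comm (a i)]; ring
  · rw [h, mul_neg_one, add_comm, ← sub_eq_add_neg]; ring

lemma integral_rademacherSum (A : Finset ℕ) (a : ℕ → ℝ) :
    ∫ ε, ∑ k ∈ A, a k * ε k ∂rademacherSeqLaw = 0 := by
  induction A using Finset.induction_on with
  | empty => simp
  | insert i A hi ih =>
    rw [integral_comp_rademacherSum_insert (F := fun u => u) continuous_id hi, ← ih]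
    exact integral_congr_ae (Eventually.of_forall fun ε => by ring)

lemma integral_rademacherSum_sq (A : Finset ℕ) (a : ℕ → ℝ) :
    ∫ ε, (∑ k ∈ A, a k * ε k) ^ 2 ∂rademacherSeqLaw = ∑ k ∈ A, a k ^ 2 := by
  induction A using Finset.induction_on with
  | empty => simp
  | insert i A hi ih =>
    rw [integral_comp_rademacherSum_insert (F := fun u => u ^ 2) (by fun_prop) hi,
      Finset.sum_insert hi, ← ih]
    have h2 := integrable_comp_rademacherSum (F := fun u => u ^ 2) (by fun_prop) A a
    calc _ = ∫ ε, (a i ^ 2 + (∑ k ∈ A, a k * ε k) ^ 2) ∂rademacherSeqLaw :=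
          integral_congr_ae (Eventually.of_forall fun ε => by ring)
      _ = _ := by rw [integral_add (integrable_const _) h2]; simp

lemma integral_rademacherSum_cube (A : Finset ℕ) (a : ℕ → ℝ) :
    ∫ ε, (∑ k ∈ A, a k * ε k) ^ 3 ∂rademacherSeqLaw = 0 := by
  induction A using Finset.induction_on with
  | empty => simp
  | insert i A hi ih =>
    rw [integral_comp_rademacherSum_insert (F := fun u => u ^ 3) (by fun_prop) hi]
    have h3 := integrable_comp_rademacherSum (F := fun u => u ^ 3) (by fun_prop) A a
    have h1 := integrable_comp_rademacherSum (F := fun u => u) (by fun_prop) A a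
    calc _ = ∫ ε, ((∑ k ∈ A, a k * ε k) ^ 3 + 3 * a i ^ 2 * (∑ k ∈ A, a k * ε k))
            ∂rademacherSeqLaw :=
          integral_congr_ae (Eventually.of_forall fun ε => by ring)
      _ = _ := by
        rw [integral_add h3 (h1.const_mul _), integral_const_mul, ih, integral_rademacherSum]
        simp

lemma integral_rademacherSum_pow_four_le (A : Finset ℕ) (a : ℕ → ℝ) :
    ∫ ε, (∑ k ∈ A, a k * ε k) ^ 4 ∂rademacherSeqLaw ≤ 3 * (∑ k ∈ A, a k ^ 2) ^ 2 := by
  induction A using Finset.induction_on with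
  | empty => simp
  | insert i A hi ih =>
    rw [integral_comp_rademacherSum_insert (F := fun u => u ^ 4) (by fun_prop) hi,
      Finset.sum_insert hi]
    have h4 := integrable_comp_rademacherSum (F := fun u => u ^ 4) (by fun_prop) A a
    have h2 := integrable_comp_rademacherSum (F := fun u => u ^ 2) (by fun_prop) A a
    calc _ = ∫ ε, ((∑ k ∈ A, a k * ε k) ^ 4 + (6 * a i ^ 2 * (∑ k ∈ A, a k * ε k) ^ 2 + a i ^ 4))
            ∂rademacherSeqLaw :=
          integral_congr_ae (Eventually.of_forall fun ε => by ring)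
      _ = ∫ ε, (∑ k ∈ A, a k * ε k) ^ 4 ∂rademacherSeqLaw
            + (6 * a i ^ 2 * ∑ k ∈ A, a k ^ 2 + a i ^ 4) := by
        have h24 : Integrable (fun ε : ℕ → ℝ => 6 * a i ^ 2 * (∑ k ∈ A, a k * ε k) ^ 2 + a i ^ 4)
            rademacherSeqLaw := (h2.const_mul _).add (integrable_const _)
        rw [integral_add h4 h24, integral_add (h2.const_mul _) (integrable_const _), integral_const_mul,
          integral_rademacherSum_sq]
        simp
      _ ≤ _ := by nlinarith [sq_nonneg (a i ^ 2)]

/-- A one-sided Paley–Zygmund bound for a normalised Rademacher sum. -/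
lemma rademacherSum_tail_of_sum_sq_eq_one {A : Finset ℕ} {a : ℕ → ℝ}
    (h1 : ∑ k ∈ A, a k ^ 2 = 1) :
    1 / 32 ≤ rademacherSeqLaw.real {ε | 1 / 20 ≤ ∑ k ∈ A, a k * ε k} := by
  -- Odd moments vanish and the fourth is at most 3, so `p` has mean at least `4 - 3 = 1`. Pointwise
  -- `p ≤ 1/2 + 16 · 1_{u ≥ 1/20}`, whence the probability is at least `(1 - 1/2) / 16`. The odd
  -- terms of `p` make it nonpositive for `u ≤ 0`, which gives a one-sided bound.
  set p : ℝ → ℝ := fun u => u * (2 - u) * (u + 2) ^ 2 with hp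
  have hpe : ∀ u, p u = (8 * u + 4 * u ^ 2) - (2 * u ^ 3 + u ^ 4) := fun u => by
    simp only [hp]; ring
  have hpc : Continuous p := by fun_prop
  have i1 := integrable_comp_rademacherSum (F := fun u => u) (by fun_prop) A a
  have i2 := integrable_comp_rademacherSum (F := fun u => u ^ 2) (by fun_prop) A a
  have i3 := integrable_comp_rademacherSum (F := fun u => u ^ 3) (by fun_prop) A a
  have i4 := integrable_comp_rademacherSum (F := fun u => u ^ 4) (by fun_prop) A a
  have hE : 1 ≤ ∫ ε, p (∑ k ∈ A, a k * ε k) ∂rademacherSeqLaw := by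
    simp only [hpe]
    have i12 : Integrable (fun ε : ℕ → ℝ => 8 * (∑ k ∈ A, a k * ε k)
        + 4 * (∑ k ∈ A, a k * ε k) ^ 2) rademacherSeqLaw := (i1.const_mul _).add (i2.const_mul _)
    have i34 : Integrable (fun ε : ℕ → ℝ => 2 * (∑ k ∈ A, a k * ε k) ^ 3
        + (∑ k ∈ A, a k * ε k) ^ 4) rademacherSeqLaw := (i3.const_mul _).add i4
    rw [integral_sub i12 i34,
      integral_add (i1.const_mul _) (i2.const_mul _), integral_add (i3.const_mul _) i4,
      integral_const_mul, integral_const_mul, integral_const_mul, integral_rademacherSum,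
      integral_rademacherSum_sq, integral_rademacherSum_cube, h1]
    have := integral_rademacherSum_pow_four_le A a
    rw [h1] at this
    linarith
  have hS : MeasurableSet {ε : ℕ → ℝ | 1 / 20 ≤ ∑ k ∈ A, a k * ε k} :=
    measurableSet_le measurable_const (measurable_rademacherSum A a)
  have hind : Integrable ({ε : ℕ → ℝ | 1 / 20 ≤ ∑ k ∈ A, a k * ε k}.indicator
      fun _ => (16 : ℝ)) rademacherSeqLaw := (integrable_const _).indicator hS
  have hle : ∫ ε, p (∑ k ∈ A, a k * ε k) ∂rademacherSeqLaw ≤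
      ∫ ε, (1 / 2 + {ε : ℕ → ℝ | 1 / 20 ≤ ∑ k ∈ A, a k * ε k}.indicator (fun _ => (16 : ℝ)) ε)
        ∂rademacherSeqLaw := by
    refine integral_mono (integrable_comp_rademacherSum hpc A a)
      ((integrable_const _).add hind) fun ε => ?_
    simp only
    generalize hu : ∑ k ∈ A, a k * ε k = u
    by_cases h : 1 / 20 ≤ u
    · rw [Set.indicator_of_mem (by simpa [hu] using h)]
      simp only [hp]
      rcases le_total u 2 with h2 | h2
      · have e1 : u * (2 - u) ≤ 1 := by nlinarith [sq_nonneg (u - 1)]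
        have e2 : (u + 2) ^ 2 ≤ 16 := by nlinarith
        nlinarith [sq_nonneg (u + 2)]
      · have : u * (2 - u) ≤ 0 := by nlinarith
        nlinarith [sq_nonneg (u + 2)]
    · rw [Set.indicator_of_notMem (by simpa [hu] using h), add_zero]
      push Not at h
      simp only [hp]
      rcases le_total u 0 with h2 | h2
      · have : u * (2 - u) ≤ 0 := by nlinarith
        nlinarith [sq_nonneg (u + 2)]
      · have e1 : u * (2 - u) ≤ 1 / 10 := by nlinarith
        have e2 : (u + 2) ^ 2 ≤ 5 := by nlinarith
        nlinarith [sq_nonneg (u + 2)]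
  rw [integral_add (integrable_const _) hind, integral_indicator_const _ hS] at hle
  simp at hle
  norm_num at hle ⊢
  linarith

lemma rademacherSum_tail (A : Finset ℕ) (a : ℕ → ℝ) :
    1 / 32 ≤ rademacherSeqLaw.real
      {ε | 1 / 20 * √(∑ k ∈ A, a k ^ 2) ≤ ∑ k ∈ A, a k * ε k} := by
  have h0 : 0 ≤ ∑ k ∈ A, a k ^ 2 := Finset.sum_nonneg fun k _ => sq_nonneg _
  rcases h0.eq_or_lt with h | h
  · have hz : ∀ k ∈ A, a k = 0 := fun k hk => by
      simpa using (Finset.sum_eq_zero_iff_of_nonneg fun k _ => sq_nonneg (a k)).1 h.symm k hk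
    have : {ε : ℕ → ℝ | 1 / 20 * √(∑ k ∈ A, a k ^ 2) ≤ ∑ k ∈ A, a k * ε k} = Set.univ := by
      ext ε
      have h0 : ∑ k ∈ A, a k * ε k = 0 := Finset.sum_eq_zero fun k hk => by rw [hz k hk, zero_mul]
      simp [← h, h0]
    rw [this, probReal_univ]
    norm_num
  · set σ := √(∑ k ∈ A, a k ^ 2) with hσ
    have hσ0 : 0 < σ := Real.sqrt_pos.2 h
    have h1 : ∑ k ∈ A, (a k / σ) ^ 2 = 1 := by
      simp only [div_pow]
      rw [← Finset.sum_div, Real.sq_sqrt h0, div_self h.ne']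
    refine (rademacherSum_tail_of_sum_sq_eq_one h1).trans (measureReal_mono fun ε hε => ?_)
    have hε' : 1 / 20 ≤ ∑ k ∈ A, a k / σ * ε k := hε
    have e : ∑ k ∈ A, a k * ε k = (∑ k ∈ A, a k / σ * ε k) * σ := by
      rw [Finset.sum_mul]
      exact Finset.sum_congr rfl fun k _ => by field_simp
    change 1 / 20 * σ ≤ ∑ k ∈ A, a k * ε k
    rw [e]
    gcongr

/-! ### Lower tails of finite Rademacher sums -/

/-- Add indices one at a time and stop when the sum first reaches 1: the last step overshoots by at
most 1. -/
lemma exists_subset_one_le_sum_le_two {ι : Type*} (A : Finset ι) {w : ι → ℝ}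
    (hw1 : ∀ k, w k ≤ 1) (hA : 1 ≤ ∑ k ∈ A, w k) :
    ∃ C ⊆ A, 1 ≤ ∑ k ∈ C, w k ∧ ∑ k ∈ C, w k ≤ 2 := by
  classical
  induction A using Finset.induction_on with
  | empty => simp at hA; linarith
  | insert i A hi ih =>
    by_cases h : 1 ≤ ∑ k ∈ A, w k
    · obtain ⟨C, hC, h1⟩ := ih h
      exact ⟨C, hC.trans (Finset.subset_insert _ _), h1⟩
    · refine ⟨insert i A, subset_rfl, hA, ?_⟩
      rw [Finset.sum_insert hi]
      linarith [hw1 i]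

lemma exp_neg_four_le : Real.exp (-4) ≤ 1 / 32 := by
  have h : (32 : ℝ) ≤ Real.exp 1 ^ 4 := by
    have := Real.exp_one_gt_d9
    calc (32 : ℝ) ≤ 2.7 ^ 4 := by norm_num
      _ ≤ _ := by gcongr; linarith
  rw [Real.exp_neg, ← one_div]
  refine one_div_le_one_div_of_le (by norm_num) ?_
  rw [← Real.exp_nat_mul] at h
  norm_num at h
  exact h

/-- By Cauchy–Schwarz `∑ |a k| y k ≤ 2 ‖a‖₂` on `A`, so the threshold is at most `‖a‖₂ / 20`. -/
lemma rademacherSum_tail_block {A : Finset ℕ} (a : ℕ → ℝ) {y : ℕ → ℝ}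
    (hA : ∑ k ∈ A, y k ^ 2 ≤ 2) :
    Real.exp (-4) ≤ rademacherSeqLaw.real
      {ε | (∑ k ∈ A, |a k| * y k) / 40 ≤ ∑ k ∈ A, a k * ε k} := by
  refine exp_neg_four_le.trans ((rademacherSum_tail A a).trans
    (measureReal_mono ?_))
  refine fun ε hε => le_trans (b := 1 / 20 * √(∑ k ∈ A, a k ^ 2)) ?_ hε
  have h := Real.sum_mul_le_sqrt_mul_sqrt A (fun k => |a k|) y
  simp only [sq_abs] at h
  have h2 : √(∑ k ∈ A, y k ^ 2) ≤ 2 := Real.sqrt_le_iff.2 ⟨by norm_num, by linarith⟩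
  nlinarith [Real.sqrt_nonneg (∑ k ∈ A, a k ^ 2)]

lemma indepFun_rademacherSum {A C : Finset ℕ} (h : Disjoint A C) (a : ℕ → ℝ) :
    IndepFun (fun ε : ℕ → ℝ => ∑ k ∈ A, a k * ε k) (fun ε => ∑ k ∈ C, a k * ε k)
      rademacherSeqLaw := by
  have e : ∀ D : Finset ℕ, (fun ε : ℕ → ℝ => ∑ k ∈ D, a k * ε k) =
      (fun u : D → ℝ => ∑ k : D, a k * u k) ∘ fun ε k => ε k := fun D => by
    funext ε
    exact (Finset.sum_coe_sort D fun k => a k * ε k).symm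
  rw [e A, e C]
  exact (iIndepFun_eval_rademacherSeqLaw.indepFun_finset A C h
    fun k => measurable_pi_apply k).comp (by fun_prop) (by fun_prop)

/-- Cut `A` into blocks on which `∑ y²` is about one, and use the Paley–Zygmund bound on each. -/
lemma rademacherSum_tail_of_weights (A : Finset ℕ) (a : ℕ → ℝ) {y : ℕ → ℝ}
    (hy0 : ∀ k, 0 ≤ y k) (hy1 : ∀ k, y k ≤ 1) :
    Real.exp (-4 * (1 + ∑ k ∈ A, y k ^ 2)) ≤ rademacherSeqLaw.real
      {ε | (∑ k ∈ A, |a k| * y k) / 40 ≤ ∑ k ∈ A, a k * ε k} := by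
  induction A using Finset.strongInduction with
  | H A ih =>
  rcases le_or_gt (∑ k ∈ A, y k ^ 2) 2 with h | h
  · refine le_trans (Real.exp_le_exp.2 ?_) (rademacherSum_tail_block a h)
    have : 0 ≤ ∑ k ∈ A, y k ^ 2 := Finset.sum_nonneg fun k _ => sq_nonneg _
    linarith
  -- Splitting off `C` costs a factor `exp (-4)`, paid for by the drop of at least 1 in `∑ y²`.
  · obtain ⟨C, hCA, hC1, hC2⟩ := exists_subset_one_le_sum_le_two A
      (fun k => pow_le_one₀ (hy0 k) (hy1 k)) (by linarith : 1 ≤ ∑ k ∈ A, y k ^ 2)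
    have hne : C.Nonempty := by
      rw [Finset.nonempty_iff_ne_empty]
      rintro rfl
      simp at hC1
      linarith
    have hD := ih (A \ C) (Finset.sdiff_ssubset hCA hne)
    have hB := rademacherSum_tail_block a hC2
    have hind := indepFun_rademacherSum (Finset.sdiff_disjoint : Disjoint (A \ C) C) a
    have hmul := hind.measure_inter_preimage_eq_mul
      (Set.Ici ((∑ k ∈ A \ C, |a k| * y k) / 40)) (Set.Ici ((∑ k ∈ C, |a k| * y k) / 40))
      measurableSet_Ici measurableSet_Ici
    have hmul' := congrArg ENNReal.toReal hmul
    rw [ENNReal.toReal_mul] at hmul'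
    have hsub : (fun ε : ℕ → ℝ => ∑ k ∈ A \ C, a k * ε k) ⁻¹'
          (Set.Ici ((∑ k ∈ A \ C, |a k| * y k) / 40)) ∩
        (fun ε : ℕ → ℝ => ∑ k ∈ C, a k * ε k) ⁻¹' (Set.Ici ((∑ k ∈ C, |a k| * y k) / 40)) ⊆
        {ε | (∑ k ∈ A, |a k| * y k) / 40 ≤ ∑ k ∈ A, a k * ε k} := by
      rintro ε ⟨h1, h2⟩
      simp only [Set.mem_preimage, Set.mem_Ici] at h1 h2
      change (∑ k ∈ A, |a k| * y k) / 40 ≤ ∑ k ∈ A, a k * ε k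
      rw [← Finset.sum_sdiff hCA, ← Finset.sum_sdiff hCA]
      linarith
    refine le_trans ?_ ((hmul'.symm.le).trans (measureReal_mono hsub))
    calc Real.exp (-4 * (1 + ∑ k ∈ A, y k ^ 2))
        ≤ Real.exp (-4 * (1 + ∑ k ∈ A \ C, y k ^ 2)) * Real.exp (-4) := by
          rw [← Real.exp_add, Real.exp_le_exp, ← Finset.sum_sdiff hCA]
          linarith
      _ ≤ _ := mul_le_mul hD hB (Real.exp_pos _).le measureReal_nonneg

/-! ### Truncation and the K-functional -/

/-- Attained duality for the K-functional of a finite sequence, at a truncation level `h`. -/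
lemma exists_truncation_weights (A : Finset ℕ) (a : ℕ → ℝ) {s : ℝ} (hs : 0 < s) :
    ∃ h : ℝ, 0 ≤ h ∧ ∃ y : ℕ → ℝ, (∀ k, 0 ≤ y k) ∧ (∀ k, y k ≤ 1) ∧
      ∑ k ∈ A, y k ^ 2 ≤ s ^ 2 ∧
      ∑ k ∈ A, (|a k| - min |a k| h) + s * √(∑ k ∈ A, min |a k| h ^ 2) ≤
        ∑ k ∈ A, |a k| * y k := by
  classical
  set T := A.filter fun k => a k ≠ 0 with hT
  -- With at most `s²` nonzero entries, level 0 works: `y` is the indicator of the support and the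
  -- left side is the `ℓ₁` norm.
  by_cases hc : (T.card : ℝ) ≤ s ^ 2
  · refine ⟨0, le_rfl, fun k => if a k ≠ 0 then 1 else 0, fun k => by dsimp only; split_ifs <;> simp,
      fun k => by dsimp only; split_ifs <;> simp, ?_, ?_⟩
    · refine le_trans (le_of_eq ?_) hc
      rw [hT, Finset.card_filter]
      push_cast
      exact Finset.sum_congr rfl fun k _ => by split_ifs <;> simp
    · have e : ∀ k, min |a k| 0 = 0 := fun k => min_eq_right (abs_nonneg (a k))
      simp only [e]
      simp
      refine Finset.sum_le_sum fun k _ => ?_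
      split_ifs with h <;> simp [h]
  · push Not at hc
    have hTne : T.Nonempty := by
      rw [← Finset.card_pos]
      exact_mod_cast (by positivity : (0 : ℝ) < s ^ 2).trans hc
    obtain ⟨i, hi, hmin⟩ := T.exists_min_image (fun k => |a k|) hTne
    have hi0 : 0 < |a i| := abs_pos.2 (Finset.mem_filter.1 hi).2
    -- A positive zero `h` of `g` makes `y = min |a k| h / h` satisfy `∑ y² = s²` exactly. `g` is
    -- nonnegative at the least nonzero `|a i|`, since more than `s²` entries reach it, and
    -- nonpositive at `‖a‖₂ / s`.
    set g : ℝ → ℝ := fun h => ∑ k ∈ A, min |a k| h ^ 2 - s ^ 2 * h ^ 2 with hg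
    have hgc : Continuous g := by fun_prop
    have hlow : 0 ≤ g |a i| := by
      have : ∑ k ∈ T, |a i| ^ 2 ≤ ∑ k ∈ A, min |a k| |a i| ^ 2 :=
        (Finset.sum_le_sum fun k hk => by rw [min_eq_right (hmin k hk)]).trans
          (Finset.sum_le_sum_of_subset_of_nonneg (Finset.filter_subset _ _)
            fun k _ _ => sq_nonneg _)
      rw [Finset.sum_const, nsmul_eq_mul] at this
      simp only [hg]
      nlinarith [sq_nonneg |a i|]
    have hsum : 0 < ∑ k ∈ A, a k ^ 2 := by
      refine lt_of_lt_of_le (by positivity : 0 < |a i| ^ 2) ?_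
      rw [sq_abs]
      exact Finset.single_le_sum (f := fun k => a k ^ 2) (fun k _ => sq_nonneg _)
        (Finset.mem_filter.1 hi).1
    have hhigh : g (√(∑ k ∈ A, a k ^ 2) / s) ≤ 0 := by
      simp only [hg]
      rw [div_pow, Real.sq_sqrt hsum.le, mul_div_cancel₀ _ (by positivity), sub_nonpos]
      refine Finset.sum_le_sum fun k _ => ?_
      rw [← sq_abs (a k)]
      exact pow_le_pow_left₀ (le_min (abs_nonneg _) (by positivity)) (min_le_left _ _) 2
    obtain ⟨h, hh, hgh⟩ := isPreconnected_Ioi.intermediate_value (s := Set.Ioi (0 : ℝ))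
      (a := √(∑ k ∈ A, a k ^ 2) / s) (b := |a i|)
      (div_pos (Real.sqrt_pos.2 hsum) hs) hi0 hgc.continuousOn ⟨hhigh, hlow⟩
    have hh0 : 0 < h := hh
    have hge : ∑ k ∈ A, min |a k| h ^ 2 = s ^ 2 * h ^ 2 := sub_eq_zero.1 hgh
    refine ⟨h, hh0.le, fun k => min |a k| h / h,
      fun k => div_nonneg (le_min (abs_nonneg _) hh0.le) hh0.le,
      fun k => div_le_one_of_le₀ (min_le_right _ _) hh0.le, ?_, ?_⟩
    · simp only [div_pow]
      rw [← Finset.sum_div, hge, mul_div_cancel_right₀ _ (by positivity)]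
    · have e : ∀ k, |a k| * (min |a k| h / h) = (|a k| - min |a k| h) + min |a k| h ^ 2 / h := by
        intro k
        rcases le_total |a k| h with h1 | h1
        · rw [min_eq_left h1]; ring
        · rw [min_eq_right h1]; field_simp; ring
      simp only [e]
      rw [Finset.sum_add_distrib, ← Finset.sum_div, hge, ← mul_pow,
        Real.sqrt_sq (by positivity)]
      refine le_of_eq ?_
      field_simp

lemma hasSum_sq_lp_two (x : lp (fun _ : ℕ => ℝ) 2) : HasSum (fun k => x k ^ 2) (‖x‖ ^ 2) := by
  have := lp.hasSum_norm (p := 2) (by norm_num) x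
  simpa using this

lemma kFunctional_le {x x' x'' : lp (fun _ : ℕ => ℝ) 2} {s : ℝ} (hs : 0 ≤ s) (h : x' + x'' = x)
    (hx' : Summable fun k => |x' k|) : kFunctional x s ≤ (∑' k, |x' k|) + s * ‖x''‖ := by
  refine csInf_le ⟨0, ?_⟩ ⟨x', x'', h, hx', rfl⟩
  rintro _ ⟨u, v, -, -, rfl⟩
  exact add_nonneg (tsum_nonneg fun k => abs_nonneg _) (mul_nonneg hs (norm_nonneg _))

/-- Take `x'` to be the excess over level `h` in the first `n` coordinates; `x''` is then the
clipped head plus the whole tail, and the last term pays for the tail. -/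
lemma kFunctional_le_truncation (x : lp (fun _ : ℕ => ℝ) 2) {s h : ℝ} (hs : 0 ≤ s) (hh : 0 ≤ h)
    (n : ℕ) :
    kFunctional x s ≤ ∑ k ∈ Finset.range n, (|x k| - min |x k| h) +
      s * √(∑ k ∈ Finset.range n, min |x k| h ^ 2) +
      s * √(‖x‖ ^ 2 - ∑ k ∈ Finset.range n, x k ^ 2) := by
  set clip : ℝ → ℝ := fun u => max (-h) (min h u) with hclip
  have hclip_abs : ∀ u, |u - clip u| = |u| - min |u| h ∧ clip u ^ 2 = min |u| h ^ 2 := by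
    intro u
    simp only [hclip]
    rcases le_total 0 u with hu | hu
    · rw [abs_of_nonneg hu, max_eq_right ((neg_nonpos.2 hh).trans (le_min hh hu)), min_comm h u,
        abs_of_nonneg (sub_nonneg.2 (min_le_left _ _))]
      exact ⟨rfl, rfl⟩
    · rw [abs_of_nonpos hu, min_eq_right (hu.trans hh)]
      have e : max (-h) u = -min (-u) h := by rw [← max_neg_neg, neg_neg, max_comm]
      rw [e, sub_neg_eq_add, abs_of_nonpos (by linarith [min_le_left (-u) h])]
      constructor <;> ring
  set f : ℕ → ℝ := fun k => if k ∈ Finset.range n then x k - clip (x k) else 0 with hf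
  have hf0 : ∀ k ∉ Finset.range n, f k = 0 := fun k hk => if_neg hk
  have hfm : Memℓp f 2 := memℓp_gen (summable_of_ne_finset_zero (s := Finset.range n)
    fun k hk => by rw [hf0 k hk]; simp)
  set x' : lp (fun _ : ℕ => ℝ) 2 := ⟨f, hfm⟩ with hx'
  have hx'k : ∀ k, x' k = f k := fun k => rfl
  have hsum' : HasSum (fun k => |x' k|) (∑ k ∈ Finset.range n, (|x k| - min |x k| h)) := by
    have : ∑ k ∈ Finset.range n, (|x k| - min |x k| h) = ∑ k ∈ Finset.range n, |x' k| :=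
      Finset.sum_congr rfl fun k hk => by
        rw [hx'k, hf]; simp only [if_pos hk]; rw [(hclip_abs _).1]
    rw [this]
    exact hasSum_sum_of_ne_finset_zero fun k hk => by rw [hx'k, hf0 k hk, abs_zero]
  have hnorm : ‖x - x'‖ ^ 2 = (∑ k ∈ Finset.range n, min |x k| h ^ 2) +
      (‖x‖ ^ 2 - ∑ k ∈ Finset.range n, x k ^ 2) := by
    have h1 := hasSum_sq_lp_two (x - x')
    have h2 : HasSum (fun k => if k ∈ Finset.range n then min |x k| h ^ 2 - x k ^ 2 else 0)
        (∑ k ∈ Finset.range n, if k ∈ Finset.range n then min |x k| h ^ 2 - x k ^ 2 else 0) :=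
      hasSum_sum_of_ne_finset_zero fun k hk => if_neg hk
    have h3 := (hasSum_sq_lp_two x).add h2
    have e : (fun k => (x - x') k ^ 2) = fun k => x k ^ 2 +
        if k ∈ Finset.range n then min |x k| h ^ 2 - x k ^ 2 else 0 := by
      funext k
      rw [lp.coeFn_sub, Pi.sub_apply, hx'k, hf]
      by_cases hk : k ∈ Finset.range n
      · simp only [if_pos hk]
        rw [sub_sub_cancel, (hclip_abs _).2]; ring
      · simp only [if_neg hk]; ring
    rw [e] at h1
    rw [h1.unique h3, Finset.sum_ite_mem, Finset.inter_self, Finset.sum_sub_distrib]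
    ring
  have hle : ‖x - x'‖ ≤ √(∑ k ∈ Finset.range n, min |x k| h ^ 2) +
      √(‖x‖ ^ 2 - ∑ k ∈ Finset.range n, x k ^ 2) := by
    rw [← Real.sqrt_sq (norm_nonneg (x - x')), hnorm]
    have hA : 0 ≤ ∑ k ∈ Finset.range n, min |x k| h ^ 2 := Finset.sum_nonneg fun k _ => sq_nonneg _
    have hB : 0 ≤ ‖x‖ ^ 2 - ∑ k ∈ Finset.range n, x k ^ 2 :=
      sub_nonneg.2 (sum_le_hasSum _ (fun k _ => sq_nonneg _) (hasSum_sq_lp_two x))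
    refine Real.sqrt_le_iff.2 ⟨by positivity, ?_⟩
    rw [add_sq, Real.sq_sqrt hA, Real.sq_sqrt hB]
    have : 0 ≤ 2 * √(∑ k ∈ Finset.range n, min |x k| h ^ 2) *
      √(‖x‖ ^ 2 - ∑ k ∈ Finset.range n, x k ^ 2) := by positivity
    linarith
  have := kFunctional_le hs (add_sub_cancel x' x) hsum'.summable
  rw [hsum'.tsum_eq] at this
  nlinarith [mul_le_mul_of_nonneg_left hle hs]

/-- The factor 1/2 absorbs the `ℓ₂` tail of `x`, which tends to zero. -/
lemma exists_half_kFunctional_le (x : lp (fun _ : ℕ => ℝ) 2) {s : ℝ} (hs : 0 < s) :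
    ∀ᶠ n in atTop, ∃ y : ℕ → ℝ, (∀ k, 0 ≤ y k) ∧ (∀ k, y k ≤ 1) ∧
      ∑ k ∈ Finset.range n, y k ^ 2 ≤ s ^ 2 ∧
      kFunctional x s / 2 ≤ ∑ k ∈ Finset.range n, |x k| * y k := by
  rcases le_or_gt (kFunctional x s) 0 with hK | hK
  · refine Eventually.of_forall fun n => ⟨0, by simp, by simp, by simp [sq_nonneg], ?_⟩
    simp
    linarith
  · have ht : Tendsto (fun n => s * √(‖x‖ ^ 2 - ∑ k ∈ Finset.range n, x k ^ 2)) atTop (𝓝 0) := by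
      have h := ((hasSum_sq_lp_two x).tendsto_sum_nat.const_sub (‖x‖ ^ 2)).sqrt.const_mul s
      simpa using h
    filter_upwards [ht.eventually_lt_const (half_pos hK)] with n hn
    obtain ⟨h, hh, y, hy0, hy1, hys, hy⟩ := exists_truncation_weights (Finset.range n) x hs
    refine ⟨y, hy0, hy1, hys, ?_⟩
    have := kFunctional_le_truncation x hs.le hh n
    linarith

/-! ### Passage to infinite series -/

lemma ae_exists_tendsto_rademacherSum {a : ℕ → ℝ} (ha : Summable fun k => a k ^ 2) :
    ∀ᵐ ε ∂rademacherSeqLaw, ∃ S : ℝ,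
      Tendsto (fun n => ∑ k ∈ Finset.range n, a k * ε k) atTop (𝓝 S) := by
  have hm : ∀ k : ℕ, StronglyMeasurable fun ε : ℕ → ℝ => ε k :=
    fun k => (measurable_pi_apply k).stronglyMeasurable
  set ℱ := Filtration.natural (fun (k : ℕ) (ε : ℕ → ℝ) => ε k) hm with hℱ
  -- The range ends at `n + 1` so that `f n` uses exactly the coordinates up to `n` and is adapted.
  set f : ℕ → (ℕ → ℝ) → ℝ := fun n ε => ∑ k ∈ Finset.range (n + 1), a k * ε k with hf
  have hint : ∀ A : Finset ℕ, Integrable (fun ε => ∑ k ∈ A, a k * ε k) rademacherSeqLaw :=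
    fun A => integrable_comp_rademacherSum (F := fun u => u) continuous_id A a
  have hadp : StronglyAdapted ℱ f := fun n =>
    Finset.stronglyMeasurable_fun_sum _ fun k hk =>
      ((Filtration.stronglyAdapted_natural hm k).mono
        (ℱ.mono (Finset.mem_range_succ_iff.1 hk))).const_mul _
  have hmart : Martingale f ℱ rademacherSeqLaw := by
    refine martingale_of_condExp_sub_eq_zero_nat hadp (fun n => hint _) fun n => ?_
    have e : f (n + 1) - f n = a (n + 1) • fun ε : ℕ → ℝ => ε (n + 1) := by
      funext ε
      simp [hf, Finset.sum_range_succ _ (n + 1)]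
    rw [e]
    refine (condExp_smul (a (n + 1)) _ _).trans ?_
    filter_upwards [iIndepFun_eval_rademacherSeqLaw.condExp_natural_ae_eq_of_lt hm
      n.lt_succ_self] with ε hε
    rw [Pi.smul_apply, hε, integral_eval_rademacherSeqLaw]
    simp
  have hbdd : ∀ n, eLpNorm (f n) 1 rademacherSeqLaw ≤
      ((1 + ∑' k, a k ^ 2).toNNReal : ℝ≥0∞) := by
    intro n
    have h2 := integrable_comp_rademacherSum (F := fun u => u ^ 2) (by fun_prop)
      (Finset.range (n + 1)) a
    rw [eLpNorm_one_eq_lintegral_enorm, ← ofReal_integral_norm_eq_lintegral_enorm (hint _)]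
    refine ENNReal.ofReal_le_ofReal ?_
    calc ∫ ε, ‖f n ε‖ ∂rademacherSeqLaw
        ≤ ∫ ε, (1 + (∑ k ∈ Finset.range (n + 1), a k * ε k) ^ 2) ∂rademacherSeqLaw := by
          refine integral_mono (hint _).norm ((integrable_const _).add h2) fun ε => ?_
          change |∑ k ∈ Finset.range (n + 1), a k * ε k| ≤
            1 + (∑ k ∈ Finset.range (n + 1), a k * ε k) ^ 2
          rw [← sq_abs]
          nlinarith [sq_nonneg (|∑ k ∈ Finset.range (n + 1), a k * ε k| - 1)]
      _ = 1 + ∑ k ∈ Finset.range (n + 1), a k ^ 2 := by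
          rw [integral_add (integrable_const _) h2, integral_rademacherSum_sq]
          simp
      _ ≤ _ := by
          gcongr
          exact ha.sum_le_tsum _ fun k _ => sq_nonneg _
  filter_upwards [hmart.submartingale.exists_ae_tendsto_of_bdd hbdd] with ε ⟨S, hS⟩
  exact ⟨S, (tendsto_add_atTop_iff_nat 1).1 hS⟩

/-- A lower tail bound valid for all large partial sums passes to the almost sure limit. -/
lemma le_measureReal_of_eventually_le {Ω : Type*} [MeasurableSpace Ω] {P : Measure Ω}
    [IsFiniteMeasure P] {f : ℕ → Ω → ℝ} (hf : ∀ n, Measurable (f n))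
    (hlim : ∀ᵐ ω ∂P, ∃ S : ℝ, Tendsto (fun n => f n ω) atTop (𝓝 S)) {θ p : ℝ}
    (hp : ∀ᶠ n in atTop, p ≤ P.real {ω | θ ≤ f n ω}) :
    p ≤ P.real {ω | ∃ S : ℝ, Tendsto (fun n => f n ω) atTop (𝓝 S) ∧ S ≥ θ} := by
  -- `E N` decreases to the event that `θ ≤ f n` infinitely often, on which any limit is at least
  -- `θ`.
  set E : ℕ → Set Ω := fun N => ⋃ n ∈ Set.Ici N, {ω | θ ≤ f n ω} with hE
  have hEm : ∀ N, MeasurableSet (E N) := fun N =>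
    MeasurableSet.biUnion (Set.to_countable _) fun n _ => measurableSet_le measurable_const (hf n)
  have hEa : Antitone E := fun M N h => Set.biUnion_subset_biUnion_left (Set.Ici_subset_Ici.2 h)
  have hEp : ∀ N, p ≤ P.real (E N) := by
    intro N
    obtain ⟨n, hn, hN⟩ := (hp.and (eventually_ge_atTop N)).exists
    exact hn.trans (measureReal_mono
      (Set.subset_biUnion_of_mem (u := fun n => {ω | θ ≤ f n ω}) hN)
      (measure_ne_top _ _))
  have ht : Tendsto (fun N => P.real (E N)) atTop (𝓝 (P.real (⋂ N, E N))) :=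
    (ENNReal.tendsto_toReal (measure_ne_top _ _)).comp
      (tendsto_measure_iInter_atTop (fun N => (hEm N).nullMeasurableSet) hEa
        ⟨0, measure_ne_top _ _⟩)
  refine (ge_of_tendsto' ht hEp).trans
    (ENNReal.toReal_mono (measure_ne_top _ _) (measure_mono_ae ?_))
  filter_upwards [hlim] with ω ⟨S, hS⟩ hω
  refine ⟨S, hS, ?_⟩
  have hfreq : ∃ᶠ n in atTop, f n ω ∈ Set.Ici θ := by
    rw [frequently_atTop]
    intro N
    obtain ⟨n, hn, h⟩ := Set.mem_iUnion₂.1 (Set.mem_iInter.1 hω N)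
    exact ⟨n, hn, h⟩
  exact isClosed_Ici.mem_of_frequently_of_tendsto hfreq hS

/-- Montgomery-Smith's lower tail bound. -/
lemma isRademacherTailConstant_eighty : IsRademacherTailConstant 80 := by
  intro x s hs
  refine le_measureReal_of_eventually_le (fun n => measurable_rademacherSum _ _)
    (ae_exists_tendsto_rademacherSum (hasSum_sq_lp_two x).summable) ?_
  -- The constant is `80 = 2 * 40`: 2 from the lost tail, 40 from the block bound; also `exp 4 ≤
  -- 80`.
  filter_upwards [exists_half_kFunctional_le x hs] with n ⟨y, hy0, hy1, hys, hy⟩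
  calc (80 : ℝ)⁻¹ * Real.exp (-80 * s ^ 2)
      ≤ Real.exp (-4) * Real.exp (-4 * s ^ 2) := by
        refine mul_le_mul ?_ (Real.exp_le_exp.2 (by nlinarith [sq_nonneg s]))
          (Real.exp_pos _).le (Real.exp_pos _).le
        have : Real.exp 1 ^ 4 ≤ 80 := by
          have := Real.exp_one_lt_d9
          calc Real.exp 1 ^ 4 ≤ 2.72 ^ 4 := by gcongr; linarith
            _ ≤ 80 := by norm_num
        rw [← Real.exp_nat_mul] at this
        norm_num at this
        rw [Real.exp_neg]
        exact inv_anti₀ (Real.exp_pos _) this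
    _ ≤ Real.exp (-4 * (1 + ∑ k ∈ Finset.range n, y k ^ 2)) := by
        rw [← Real.exp_add, Real.exp_le_exp]
        linarith
    _ ≤ _ := rademacherSum_tail_of_weights _ x hy0 hy1
    _ ≤ _ := measureReal_mono fun ε hε => by
        have h : (∑ k ∈ Finset.range n, |x k| * y k) / 40 ≤
          ∑ k ∈ Finset.range n, x k * ε k := hε
        change (80 : ℝ)⁻¹ * kFunctional x s ≤ ∑ k ∈ Finset.range n, x k * ε k
        linarith

/-! ### Half space depth -/

/-- The easy half of the duality between the K-functional and the norm
`max (‖·‖_∞, s⁻¹ * ‖·‖₂)`. -/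
lemma tsum_mul_le_kFunctional {x : lp (fun _ : ℕ => ℝ) 2} {y : ℕ → ℝ} {s M : ℝ}
    (hM : 0 < M) (hsum : Summable fun k => y k ^ 2) (h1 : ∀ k, |y k| ≤ M)
    (h2 : √(∑' k, y k ^ 2) ≤ M * s) : ∑' k, x k * y k ≤ M * kFunctional x s := by
  have hy : Memℓp y 2 := memℓp_gen (by simpa using hsum)
  -- For each decomposition, the sup bound on `y` handles `x'` and Cauchy–Schwarz handles `x''`.
  have key : ∀ r ∈ {r : ℝ | ∃ x' x'' : lp (fun _ : ℕ => ℝ) 2,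
      x' + x'' = x ∧ Summable (fun k => |x' k|) ∧ r = (∑' k, |x' k|) + s * ‖x''‖},
      ∑' k, x k * y k ≤ M * r := by
    rintro _ ⟨x', x'', rfl, hx', rfl⟩
    have hle : ∀ k, |x' k * y k| ≤ M * |x' k| := fun k => by
      rw [abs_mul, mul_comm]
      exact mul_le_mul_of_nonneg_right (h1 k) (abs_nonneg _)
    have hs1 : Summable fun k => x' k * y k :=
      Summable.of_abs (Summable.of_nonneg_of_le (fun k => abs_nonneg _) hle (hx'.mul_left M))
    have hin := lp.hasSum_inner (𝕜 := ℝ) x'' (⟨y, hy⟩ : lp (fun _ : ℕ => ℝ) 2)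
    have hin' : HasSum (fun k => x'' k * y k) (inner ℝ x'' (⟨y, hy⟩ : lp (fun _ : ℕ => ℝ) 2)) := by
      simpa [mul_comm] using hin
    have hyn : ‖(⟨y, hy⟩ : lp (fun _ : ℕ => ℝ) 2)‖ = √(∑' k, y k ^ 2) := by
      rw [← Real.sqrt_sq (norm_nonneg _), ← (hasSum_sq_lp_two _).tsum_eq]
    have e : (fun k => (x' + x'') k * y k) = fun k => x' k * y k + x'' k * y k := by
      funext k
      rw [lp.coeFn_add, Pi.add_apply, add_mul]
    rw [e, hs1.tsum_add hin'.summable, hin'.tsum_eq, mul_add]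
    have t1 : ∑' k, x' k * y k ≤ M * ∑' k, |x' k| := by
      rw [← tsum_mul_left]
      exact hs1.tsum_le_tsum (fun k => (le_abs_self _).trans (hle k)) (hx'.mul_left M)
    have t2 : inner ℝ x'' (⟨y, hy⟩ : lp (fun _ : ℕ => ℝ) 2) ≤ M * (s * ‖x''‖) := by
      refine (real_inner_le_norm _ _).trans ?_
      rw [hyn]
      nlinarith [mul_le_mul_of_nonneg_left h2 (norm_nonneg x'')]
    exact add_le_add t1 t2
  rw [← div_le_iff₀' hM]
  refine le_csInf ⟨_, 0, x, zero_add x, by simp, rfl⟩ fun r hr => ?_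
  rw [div_le_iff₀' hM]
  exact key r hr

theorem proposition5 :
    (∃ c : ℝ, 0 < c ∧ IsRademacherTailConstant c) ∧
    ∀ c : ℝ, 0 < c → IsRademacherTailConstant c →
      ∀ (B : Type*) [AddCommGroup B] [Module ℝ B] [MetricSpace B] [IsTopologicalAddGroup B]
        [ContinuousSMul ℝ B] [CompleteSpace B] [TopologicalSpace.SeparableSpace B]
        [MeasurableSpace B] [BorelSpace B]
        (_ : ∀ x y z : B, dist (x + z) (y + z) = dist x y)
        (Ω : Type*) [MeasurableSpace Ω] (P : Measure Ω) [IsProbabilityMeasure P]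
        (X : Ω → B) (_ : Measurable X)
        (t : ℕ → B → ℝ) (_ : ∀ k, Measurable (t k))
        (_ : iIndepFun (fun k ω => t k (X ω)) P)
        (_ : ∀ k, P.map (fun ω => t k (X ω)) = rademacherLaw)
        (a : B) (_ : Summable fun k => t k a ^ 2)
        (t₀ : ℝ) (_ : 0 < t₀)
        (_ : max (c * ⨆ k, |t k a|) (t₀⁻¹ * c * Real.sqrt (∑' k, t k a ^ 2)) ≤ 1),
        halfSpaceDepth (Submodule.span ℝ (Set.range t) : Set (B → ℝ)) a (P.map X) ≥
          c⁻¹ * Real.exp (-c * t₀ ^ 2) := by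
  refine ⟨⟨80, by norm_num, isRademacherTailConstant_eighty⟩, ?_⟩
  intro c hc hctail B _ _ _ _ _ _ _ _ _ _ Ω _ P _ X hX t ht hindep hlaw a ha t₀ ht₀ hmax
  obtain ⟨hmax1, hmax2⟩ := max_le_iff.1 hmax
  have hbdd : BddAbove (Set.range fun k => |t k a|) := by
    refine ⟨√(∑' k, t k a ^ 2), ?_⟩
    rintro _ ⟨k, rfl⟩
    exact Real.abs_le_sqrt (ha.le_tsum k fun j _ => sq_nonneg _)
  have hsup : ∀ k, |t k a| ≤ c⁻¹ := fun k => by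
    rw [← one_div, le_div_iff₀' hc]
    exact (mul_le_mul_of_nonneg_left (le_ciSup hbdd k) hc.le).trans hmax1
  have hl2 : √(∑' k, t k a ^ 2) ≤ c⁻¹ * t₀ := by
    rw [mul_assoc, inv_mul_le_iff₀ ht₀, mul_one] at hmax2
    rwa [inv_mul_eq_div, le_div_iff₀' hc]
  have htX : ∀ k, Measurable fun ω => t k (X ω) := fun k => (ht k).comp hX
  have hmap : P.map (fun ω k => t k (X ω)) = rademacherSeqLaw := by
    have h := hindep.map_fun_eq_infinitePi_map htX
    simp only [hlaw] at h
    exact h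
  have hne : Nonempty (Submodule.span ℝ (Set.range t) : Set (B → ℝ)) := ⟨0, Submodule.zero_mem _⟩
  refine le_ciInf ?_
  rintro ⟨g, hg⟩
  obtain ⟨b, rfl⟩ := (Finsupp.mem_span_range_iff_exists_finsupp).1 hg
  have hgx : ∀ z, (b.sum fun k r => r • t k) z = ∑ k ∈ b.support, b k * t k z := fun z => by
    simp [Finsupp.sum]
  have hbm : Memℓp (b : ℕ → ℝ) 2 := memℓp_gen (summable_of_ne_finset_zero (s := b.support)
    fun k hk => by simp [Finsupp.notMem_support_iff.1 hk])
  set x : lp (fun _ : ℕ => ℝ) 2 := ⟨fun k => b k, hbm⟩ with hx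
  have hxk : ∀ k, x k = b k := fun k => rfl
  have hK : ∑ k ∈ b.support, b k * t k a ≤ c⁻¹ * kFunctional x t₀ := by
    have h := tsum_mul_le_kFunctional (x := x) (inv_pos.2 hc) ha hsup hl2
    rwa [tsum_eq_sum (s := b.support) fun k hk => by
      rw [hxk, Finsupp.notMem_support_iff.1 hk, zero_mul]] at h
  have hgm : Measurable (b.sum fun k r => r • t k) := by
    rw [funext hgx]
    exact Finset.measurable_sum _ fun k _ => (ht k).const_mul _
  have hset : MeasurableSet {ε : ℕ → ℝ | ∑ k ∈ b.support, b k * t k a ≤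
      ∑ k ∈ b.support, b k * ε k} :=
    measurableSet_le measurable_const (measurable_rademacherSum _ _)
  have hreal : (P.map X).real {z | (b.sum fun k r => r • t k) z ≥
      (b.sum fun k r => r • t k) a} = rademacherSeqLaw.real
      {ε | ∑ k ∈ b.support, b k * t k a ≤ ∑ k ∈ b.support, b k * ε k} := by
    rw [← hmap, map_measureReal_apply hX (measurableSet_le measurable_const hgm),
      map_measureReal_apply (measurable_pi_lambda _ htX) hset]
    simp only [hgx]
    rfl
  change _ ≤ (P.map X).real {z | (b.sum fun k r => r • t k) z ≥ (b.sum fun k r => r • t k) a}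
  rw [hreal]
  refine (hctail x t₀ ht₀).trans (measureReal_mono ?_)
  rintro ε ⟨S, hS, hSge⟩
  -- `b` has finite support, so the limit of the partial sums is the finite sum itself.
  have hS' : HasSum (fun k => x k * ε k) (∑ k ∈ b.support, b k * ε k) := by
    exact hasSum_sum_of_ne_finset_zero fun k hk => by
      rw [hxk, Finsupp.notMem_support_iff.1 hk, zero_mul]
  rw [tendsto_nhds_unique hS hS'.tendsto_sum_nat] at hSge
  exact hK.trans hSge
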